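/- **Setting.** Let $\mathcal H$ be a separable complex Hilbert space and let $h$ be a (possibly unbounded) self-adjoint operator on $\mathcal H$ with compact resolvent. Let $\mathcal H_N=\mathcal H^{\otimes N}$ be the Hilbert space tensor power, and let $H_N=\sum_{j=1}^N h_j$, where $h_j$ acts as $h$ on the $j$th factor ($H_N$ is the closure of this sum on the span of the product vectors with factors in the domain of $h$). For an eigenvalue $E$ of $H_N$ let $P_E$ be the orthogonal projection onto the corresponding eigenspace, and let $\mathcal A_N$ be the algebra of all operators $\sum_E f(E)P_E$ (strongly convergent sum over the eigenvalues of $H_N$), $f$ a bounded complex function. A *collision specification* $(\mathcal C,U,\nu)$ consists of a compact metric space $\mathcal C$, an injective map $U$ from $\mathcal C$ to the unitary operators on $\mathcal H_2=\mathcal H\otimes\mathcal H$ that is continuous in the strong operator topology (in particular, it may be norm continuous), and a Borel probability measure $\nu$ on $\mathcal C$ that charges every non-empty open set, such that (i) $U(\sigma)H_2U(\sigma)^*=H_2$ for all $\sigma\in\mathcal C$; (ii) $U(\sigma_0)=1$ for some $\sigma_0\in\mathcal C$; (iii) $\{U(\sigma):\sigma\in\mathcal C\}=\{U(\sigma)^*:\sigma\in\mathcal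 C\}$, and the map $\sigma\mapsto\sigma'$ with $U(\sigma)^*=U(\sigma')$ is measurable and leaves $\nu$ invariant; (iv) with the swap $V(\phi\otimes\psi)=\psi\otimes\phi$, $\{U(\sigma):\sigma\in\mathcal C\}=\{VU(\sigma)V^*:\sigma\in\mathcal C\}$, and the map $\sigma\mapsto\sigma'$ with $VU(\sigma)V^*=U(\sigma')$ is measurable and leaves $\nu$ invariant. It is *(2-)ergodic* if the commutant $\{U(\sigma):\sigma\in\mathcal C\}'$ in the bounded operators on $\mathcal H_2$ equals $\mathcal A_2$. For $1\le i<j\le N$ let $U_{i,j}(\sigma)$ be the operator on $\mathcal H_N$ that acts as $U(\sigma)$ on the $i$th and $j$th factors and as the identity on the others, and let $$\mathscr C_N=\{U_{i,j}(\sigma): 1\le i<j\le N,\ \sigma\in\mathcal C\}'$$ be the commutant in the bounded operators on $\mathcal H_N$. **Theorem.** Let $(\mathcal C,U,\nu)$ be a (2-)ergodic collision specification and let $N\ge 2$. Then $\mathscr C_N$ is a commutative algebra. In fact, if $\{\psi_j\}_{j\in\mathcal J}$ is any orthonormal basis of $\mathcal H$ consisting of eigenvectors of $h$, then every $A\in\mathscr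 C_N$ is diagonal in the basis $\Psi_\alpha=\psi_{\alpha_1}\otimes\cdots\otimes\psi_{\alpha_N}$, $\alpha\in\mathcal J^N$, of $\mathcal H_N$: each $\Psi_\alpha$ is an eigenvector of $A$. -/

import Mathlib

open MeasureTheory

namespace QuantumKac

universe u

/-! ## The Hilbert space tensor power -/

section TensorPower

variable (N : ℕ) (H : Type u) [NormedAddCommGroup H] [InnerProductSpace ℂ H]

/-- The algebraic `N`-fold tensor power of `H`.  (A type synonym, so that it does not carry the
projective seminorm that Mathlib puts on tensor products of normed spaces.) -/
def AlgTensor : Type u := PiTensorProduct ℂ (fun _ : Fin N => H)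

noncomputable instance : AddCommGroup (AlgTensor N H) :=
  inferInstanceAs (AddCommGroup (PiTensorProduct ℂ (fun _ : Fin N => H)))

noncomputable instance : Module ℂ (AlgTensor N H) :=
  inferInstanceAs (Module ℂ (PiTensorProduct ℂ (fun _ : Fin N => H)))

variable {N H}

/-- The elementary tensor `φ₁ ⊗ ⋯ ⊗ φ_N` in the algebraic tensor power. -/
noncomputable def algPure : MultilinearMap ℂ (fun _ : Fin N => H) (AlgTensor N H) :=
  PiTensorProduct.tprod ℂ

theorem algTensor_induction {p : AlgTensor N H → Prop} (z : AlgTensor N H)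
    (hs : ∀ (r : ℂ) (φ : Fin N → H), p (r • algPure φ))
    (ha : ∀ x y, p x → p y → p (x + y)) : p z :=
  PiTensorProduct.induction_on z hs ha

/-- The linear functional `y₁ ⊗ ⋯ ⊗ y_N ↦ ∏ k, ⟪φ k, y k⟫`. -/
noncomputable def pairing (φ : Fin N → H) : AlgTensor N H →ₗ[ℂ] ℂ :=
  PiTensorProduct.lift
    ((MultilinearMap.mkPiAlgebra ℂ (Fin N) ℂ).compLinearMap fun k => innerₛₗ ℂ (φ k))

theorem pairing_pure (φ y : Fin N → H) :
    pairing φ (algPure y) = ∏ k, inner ℂ (φ k) (y k) := by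
  unfold pairing algPure
  erw [PiTensorProduct.lift.tprod]
  simp

/-- For fixed `y`, the complex conjugate of `φ ↦ pairing φ y`; it is multilinear in `φ`. -/
noncomputable def conjPairing (y : AlgTensor N H) :
    MultilinearMap ℂ (fun _ : Fin N => H) ℂ where
  toFun φ := star (pairing φ y)
  map_update_add' := by
    intro hd φ i a b
    have hd' : hd = instDecidableEqFin N := Subsingleton.elim _ _
    subst hd'
    induction y using algTensor_induction with
    | hs r x =>
      have key := ((MultilinearMap.mkPiAlgebra ℂ (Fin N) ℂ).compLinearMap
        fun k => innerₛₗ ℂ (x k)).map_update_add φ i a b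
      simp only [MultilinearMap.compLinearMap_apply, MultilinearMap.mkPiAlgebra_apply,
        innerₛₗ_apply_apply] at key
      simp only [map_smul, pairing_pure, smul_eq_mul, star_mul', star_prod,
        RCLike.star_def, inner_conj_symm, key, mul_add]
    | ha x z hx hz => simp only [map_add, star_add, hx, hz]; ring
  map_update_smul' := by
    intro hd φ i c a
    have hd' : hd = instDecidableEqFin N := Subsingleton.elim _ _
    subst hd'
    induction y using algTensor_induction with
    | hs r x =>
      have key := ((MultilinearMap.mkPiAlgebra ℂ (Fin N) ℂ).compLinearMap
        fun k => innerₛₗ ℂ (x k)).map_update_smul φ i c a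
      simp only [MultilinearMap.compLinearMap_apply, MultilinearMap.mkPiAlgebra_apply,
        innerₛₗ_apply_apply, smul_eq_mul] at key
      simp only [map_smul, pairing_pure, smul_eq_mul, star_mul', star_prod,
        RCLike.star_def, inner_conj_symm, key]
      ring
    | ha x z hx hz => simp only [map_add, star_add, hx, hz, smul_add]

/-- The sesquilinear form on the algebraic tensor power that is determined by
`⟪x₁ ⊗ ⋯ ⊗ x_N, y₁ ⊗ ⋯ ⊗ y_N⟫ = ∏ k, ⟪x k, y k⟫`. -/
noncomputable def algInner (x y : AlgTensor N H) : ℂ :=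
  star ((PiTensorProduct.lift (conjPairing y) : AlgTensor N H →ₗ[ℂ] ℂ) x)

theorem algInner_pure_left (φ : Fin N → H) (y : AlgTensor N H) :
    algInner (algPure φ) y = pairing φ y := by
  unfold algInner algPure
  erw [PiTensorProduct.lift.tprod]
  simp [conjPairing]

theorem algInner_pure (φ y : Fin N → H) :
    algInner (algPure φ) (algPure y) = ∏ k, inner ℂ (φ k) (y k) := by
  rw [algInner_pure_left, pairing_pure]

theorem algInner_add_left (x x' y : AlgTensor N H) :
    algInner (x + x') y = algInner x y + algInner x' y :=
  (congrArg star (map_add (PiTensorProduct.lift (conjPairing y)) x x')).trans (star_add _ _)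

theorem algInner_smul_left (c : ℂ) (x y : AlgTensor N H) :
    algInner (c • x) y = star c * algInner x y :=
  (congrArg star (map_smul (PiTensorProduct.lift (conjPairing y)) c x)).trans (star_mul' _ _)

theorem algInner_add_right (x y y' : AlgTensor N H) :
    algInner x (y + y') = algInner x y + algInner x y' := by
  induction x using algTensor_induction with
  | hs r φ => simp only [algInner_smul_left, algInner_pure_left, map_add, mul_add]
  | ha a b ha hb => simp only [algInner_add_left, ha, hb]; ring

theorem algInner_smul_right (c : ℂ) (x y : AlgTensor N H) :
    algInner x (c • y) = c * algInner x y := by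
  induction x using algTensor_induction with
  | hs r φ => simp only [algInner_smul_left, algInner_pure_left, map_smul, smul_eq_mul]; ring
  | ha a b ha hb => simp only [algInner_add_left, ha, hb]; ring

theorem algInner_conj_symm (x y : AlgTensor N H) : star (algInner y x) = algInner x y := by
  induction x using algTensor_induction with
  | hs r φ =>
    induction y using algTensor_induction with
    | hs s y =>
      simp only [algInner_smul_left, algInner_smul_right, algInner_pure, star_mul', star_prod,
        RCLike.star_def, inner_conj_symm, Complex.conj_conj]
      ring
    | ha a b ha hb => simp only [algInner_add_left, algInner_add_right, star_add, ha, hb]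
  | ha a b ha hb => simp only [algInner_add_left, algInner_add_right, star_add, ha, hb]

open scoped ComplexOrder in
theorem posSemidef_prod_gram {ι : Type*} [Fintype ι] (x : ι → Fin N → H) (s : Finset (Fin N)) :
    (Matrix.of fun a b => ∏ k ∈ s, inner ℂ (x a k) (x b k) : Matrix ι ι ℂ).PosSemidef := by
  classical
  induction s using Finset.induction_on with
  | empty =>
    have h1 := Matrix.posSemidef_gram (n := ι) ℂ (fun _ => (1 : ℂ))
    have h2 : (Matrix.of fun a b => ∏ k ∈ (∅ : Finset (Fin N)), inner ℂ (x a k) (x b k) :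
        Matrix ι ι ℂ) = Matrix.gram ℂ fun _ => (1 : ℂ) := by
      ext a b
      simp [Matrix.gram]
    rw [h2]
    exact h1
  | insert k s hk ih =>
    have h1 := (Matrix.posSemidef_gram (n := ι) ℂ (fun a => x a k)).hadamard ih
    have h2 : (Matrix.of fun a b => ∏ l ∈ insert k s, inner ℂ (x a l) (x b l) :
        Matrix ι ι ℂ) = (Matrix.gram ℂ fun a => x a k).hadamard
          (Matrix.of fun a b => ∏ l ∈ s, inner ℂ (x a l) (x b l)) := by
      ext a b
      simp [Matrix.gram, Finset.prod_insert hk]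
    rw [h2]
    exact h1

theorem exists_finite_sum (z : AlgTensor N H) :
    ∃ (n : ℕ) (c : Fin n → ℂ) (x : Fin n → Fin N → H), z = ∑ a, c a • algPure (x a) := by
  induction z using algTensor_induction with
  | hs r φ => exact ⟨1, fun _ => r, fun _ => φ, by simp⟩
  | ha y z hy hz =>
    obtain ⟨n, c, x, rfl⟩ := hy
    obtain ⟨m, d, w, rfl⟩ := hz
    exact ⟨n + m, Fin.append c d, Fin.append x w, by simp [Fin.sum_univ_add]⟩

open scoped ComplexOrder in
theorem algInner_self_nonneg (z : AlgTensor N H) : 0 ≤ (algInner z z).re := by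
  obtain ⟨n, c, x, rfl⟩ := exists_finite_sum z
  have hl : ∀ y : AlgTensor N H, algInner (∑ a, c a • algPure (x a)) y
      = ∑ a, star (c a) * algInner (algPure (x a)) y := by
    intro y
    let L : AlgTensor N H →+ ℂ := AddMonoidHom.mk' (fun w => algInner w y)
      fun a b => algInner_add_left a b y
    change L _ = _
    rw [map_sum]
    exact Finset.sum_congr rfl fun a _ => algInner_smul_left _ _ _
  have hr : ∀ a, algInner (algPure (x a)) (∑ b, c b • algPure (x b))
      = ∑ b, c b * ∏ k, inner ℂ (x a k) (x b k) := by
    intro a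
    rw [algInner_pure_left, map_sum]
    exact Finset.sum_congr rfl fun b _ => by rw [map_smul, pairing_pure, smul_eq_mul]
  have hp := (posSemidef_prod_gram x Finset.univ).dotProduct_mulVec_nonneg c
  have he : algInner (∑ a, c a • algPure (x a)) (∑ a, c a • algPure (x a))
      = star c ⬝ᵥ (Matrix.of fun a b => ∏ k, inner ℂ (x a k) (x b k)).mulVec c := by
    rw [hl]
    simp only [hr, dotProduct, Matrix.mulVec, Matrix.of_apply, Pi.star_apply]
    exact Finset.sum_congr rfl fun a _ => by
      congr 1
      exact Finset.sum_congr rfl fun b _ => mul_comm _ _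
  rw [he]
  exact (Complex.le_def.mp hp).1

/-- The (pre-)inner product of the algebraic tensor power. -/
@[reducible]
noncomputable def algCore : PreInnerProductSpace.Core ℂ (AlgTensor N H) where
  inner := algInner
  conj_inner_symm := algInner_conj_symm
  re_inner_nonneg := algInner_self_nonneg
  add_left := algInner_add_left
  smul_left x y c := algInner_smul_left c x y

noncomputable instance : SeminormedAddCommGroup (AlgTensor N H) :=
  InnerProductSpace.Core.toSeminormedAddCommGroup (c := algCore)

noncomputable instance : InnerProductSpace ℂ (AlgTensor N H) :=
  InnerProductSpace.ofCore algCore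

variable (N H)

/-- The Hilbert space `H^{⊗N}`: the completion of the algebraic tensor power. -/
abbrev TensorPower : Type u := UniformSpace.Completion (AlgTensor N H)

variable {N H}

/-- The elementary tensor `φ₁ ⊗ ⋯ ⊗ φ_N` in `H^{⊗N}`. -/
noncomputable def prodVec (φ : Fin N → H) : TensorPower N H :=
  ((algPure φ : AlgTensor N H) : UniformSpace.Completion (AlgTensor N H))

theorem inner_prodVec (φ y : Fin N → H) :
    inner ℂ (prodVec φ) (prodVec y) = ∏ k, inner ℂ (φ k) (y k) :=
  (UniformSpace.Completion.inner_coe _ _).trans (algInner_pure φ y)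

theorem dense_span_prodVec :
    Dense (Submodule.span ℂ (Set.range (prodVec (N := N) (H := H))) : Set (TensorPower N H)) := by
  have hd := UniformSpace.Completion.denseRange_coe (α := AlgTensor N H)
  refine hd.mono ?_
  rintro _ ⟨z, rfl⟩
  induction z using algTensor_induction with
  | hs r φ =>
    rw [UniformSpace.Completion.coe_smul]
    exact Submodule.smul_mem _ _ (Submodule.subset_span ⟨φ, rfl⟩)
  | ha x y hx hy =>
    rw [UniformSpace.Completion.coe_add]
    exact Submodule.add_mem _ hx hy

theorem continuous_prodVec : Continuous (prodVec (N := N) (H := H)) := by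
  rw [continuous_iff_continuousAt]
  intro θ
  rw [ContinuousAt, tendsto_iff_norm_sub_tendsto_zero]
  have hsq : ∀ φ : Fin N → H, ‖prodVec φ - prodVec θ‖ ^ 2
      = (∏ k, inner ℂ (φ k) (φ k) - ∏ k, inner ℂ (φ k) (θ k) - ∏ k, inner ℂ (θ k) (φ k)
          + ∏ k, inner ℂ (θ k) (θ k) : ℂ).re := by
    intro φ
    rw [← inner_self_eq_norm_sq (𝕜 := ℂ), inner_sub_left, inner_sub_right, inner_sub_right]
    simp only [inner_prodVec, RCLike.re_eq_complex_re]
    congr 1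
    ring
  have hc : Continuous fun φ : Fin N → H => √((∏ k, inner ℂ (φ k) (φ k)
      - ∏ k, inner ℂ (φ k) (θ k) - ∏ k, inner ℂ (θ k) (φ k)
          + ∏ k, inner ℂ (θ k) (θ k) : ℂ).re) := by
    fun_prop
  have h0 := hc.tendsto θ
  simp only [sub_self, zero_sub, neg_add_cancel, Complex.zero_re, Real.sqrt_zero] at h0
  refine h0.congr fun φ => ?_
  rw [← hsq, Real.sqrt_sq (norm_nonneg _)]

end TensorPower

/-! ## Operators defined on elementary tensors -/

section Extension

variable {I : Type*} {K L : Type*} [NormedAddCommGroup K] [InnerProductSpace ℂ K]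
  [NormedAddCommGroup L] [InnerProductSpace ℂ L] [CompleteSpace L]

/-- The bounded operator `K → L` that sends `v a` to `w a` for every `a`, where the vectors `v a`
span a dense subspace of `K` (and where the prescription is bounded on that span). -/
noncomputable def extendBounded (v : I → K) (w : I → L) : K →L[ℂ] L :=
  (Finsupp.linearCombination ℂ w).extendOfNorm (Finsupp.linearCombination ℂ v)

theorem extendBounded_apply (v : I → K) (w : I → L)
    (hv : Dense (Submodule.span ℂ (Set.range v) : Set K)) (c : ℝ)
    (hvw : ∀ a b, inner ℂ (w a) (w b) = (c : ℂ) * inner ℂ (v a) (v b)) (a : I) :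
    extendBounded v w (v a) = w a := by
  have hsum : ∀ f : I →₀ ℂ,
      inner ℂ (Finsupp.linearCombination ℂ w f) (Finsupp.linearCombination ℂ w f)
        = (c : ℂ) * inner ℂ (Finsupp.linearCombination ℂ v f)
            (Finsupp.linearCombination ℂ v f) := by
    intro f
    simp only [Finsupp.linearCombination_apply, Finsupp.sum, sum_inner, inner_sum,
      inner_smul_left, inner_smul_right, hvw, Finset.mul_sum]
    refine Finset.sum_congr rfl fun x _ => Finset.sum_congr rfl fun y _ => by ring
  have hsq : ∀ f : I →₀ ℂ, ‖Finsupp.linearCombination ℂ w f‖ ^ 2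
      = c * ‖Finsupp.linearCombination ℂ v f‖ ^ 2 := by
    intro f
    have := hsum f
    rw [inner_self_eq_norm_sq_to_K, inner_self_eq_norm_sq_to_K] at this
    apply Complex.ofReal_injective
    push_cast
    exact this
  have hb : ∃ C : ℝ, ∀ f : I →₀ ℂ, ‖Finsupp.linearCombination ℂ w f‖
      ≤ C * ‖Finsupp.linearCombination ℂ v f‖ := by
    refine ⟨√|c|, fun f => ?_⟩
    refine abs_le_of_sq_le_sq' ?_ (by positivity) |>.2
    rw [mul_pow, Real.sq_sqrt (abs_nonneg c), hsq f]
    exact mul_le_mul_of_nonneg_right (le_abs_self c) (by positivity)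
  have hd : DenseRange (Finsupp.linearCombination ℂ v) := by
    have : Set.range (Finsupp.linearCombination ℂ v)
        = (Submodule.span ℂ (Set.range v) : Set K) := by
      rw [← Finsupp.range_linearCombination]
      rfl
    unfold DenseRange
    rw [this]
    exact hv
  have := LinearMap.extendOfNorm_eq hd hb (Finsupp.single a (1 : ℂ))
  simpa [extendBounded] using this

end Extension

section PairOperators

variable {N : ℕ} {H : Type u} [NormedAddCommGroup H] [InnerProductSpace ℂ H]

/-- The factors of a product vector, with the `i`th replaced by `x` and the `j`th by `y`. -/
def replacePair {M : ℕ} {G : Type*} (i j : Fin M) (φ : Fin M → G) (x y : G) : Fin M → G :=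
  Function.update (Function.update φ i x) j y

/-- For `i ≠ j`, the bounded operator `H ⊗ H → H^{⊗N}` that puts a vector of `H ⊗ H` in the
factors `i` and `j` and keeps `φ k` in every other factor `k`:
`x ⊗ y ↦ φ₁ ⊗ ⋯ ⊗ x ⊗ ⋯ ⊗ y ⊗ ⋯ ⊗ φ_N`. -/
noncomputable def insertPair (i j : Fin N) (φ : Fin N → H) :
    TensorPower 2 H →L[ℂ] TensorPower N H :=
  extendBounded (prodVec (N := 2)) fun x => prodVec (replacePair i j φ (x 0) (x 1))

/-- For `i ≠ j` and an operator `B` on `H ⊗ H`, the operator `B_{i,j}` on `H^{⊗N}` in which `B`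
acts on the factors `i` and `j` and the identity on the others. -/
noncomputable def pairOp (i j : Fin N) (B : TensorPower 2 H →L[ℂ] TensorPower 2 H) :
    TensorPower N H →L[ℂ] TensorPower N H :=
  extendBounded (prodVec (N := N)) fun φ => insertPair i j φ (B (prodVec ![φ i, φ j]))

theorem prod_replacePair {i j : Fin N} (hij : i ≠ j) (φ θ : Fin N → H) (x y x' y' : H) :
    ∏ k, inner ℂ (replacePair i j φ x y k) (replacePair i j θ x' y' k)
      = (∏ k ∈ (Finset.univ.erase j).erase i, inner ℂ (φ k) (θ k))
          * (inner ℂ x x' * inner ℂ y y') := by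
  rw [← Finset.mul_prod_erase Finset.univ _ (Finset.mem_univ j),
    ← Finset.mul_prod_erase (Finset.univ.erase j) _
      (Finset.mem_erase.mpr ⟨hij, Finset.mem_univ i⟩)]
  have : ∏ k ∈ (Finset.univ.erase j).erase i,
      inner ℂ (replacePair i j φ x y k) (replacePair i j θ x' y' k)
      = ∏ k ∈ (Finset.univ.erase j).erase i, inner ℂ (φ k) (θ k) := by
    refine Finset.prod_congr rfl fun k hk => ?_
    simp only [Finset.mem_erase, Finset.mem_univ, and_true] at hk
    simp [replacePair, hk.1, hk.2]
  rw [this]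
  simp [replacePair, hij]
  ring

theorem insertPair_prodVec {i j : Fin N} (hij : i ≠ j) (φ : Fin N → H) (x : Fin 2 → H) :
    insertPair i j φ (prodVec x) = prodVec (replacePair i j φ (x 0) (x 1)) := by
  refine extendBounded_apply _ _ dense_span_prodVec
    (∏ k ∈ (Finset.univ.erase j).erase i, ‖φ k‖ ^ 2) (fun a b => ?_) x
  rw [inner_prodVec, inner_prodVec, prod_replacePair hij, Fin.prod_univ_two]
  congr 1
  push_cast
  exact Finset.prod_congr rfl fun k _ => inner_self_eq_norm_sq_to_K _

theorem inner_insertPair {i j : Fin N} (hij : i ≠ j) (φ θ : Fin N → H) (u v : TensorPower 2 H) :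
    inner ℂ (insertPair i j φ u) (insertPair i j θ v)
      = (∏ k ∈ (Finset.univ.erase j).erase i, inner ℂ (φ k) (θ k)) * inner ℂ u v := by
  set c : ℂ := ∏ k ∈ (Finset.univ.erase j).erase i, inner ℂ (φ k) (θ k) with hc
  have pp : ∀ x y : Fin 2 → H,
      inner ℂ (insertPair i j φ (prodVec x)) (insertPair i j θ (prodVec y))
        = c * inner ℂ (prodVec x) (prodVec y) := fun x y => by
    rw [insertPair_prodVec hij, insertPair_prodVec hij, inner_prodVec, inner_prodVec, prod_replacePair hij,
      Fin.prod_univ_two]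
  have pv : ∀ (x : Fin 2 → H) (v : TensorPower 2 H),
      inner ℂ (insertPair i j φ (prodVec x)) (insertPair i j θ v) = c * inner ℂ (prodVec x) v := by
    intro x v
    have : innerSL ℂ (insertPair i j φ (prodVec x)) ∘L insertPair i j θ = c • innerSL ℂ (prodVec x) := by
      refine ContinuousLinearMap.ext_on dense_span_prodVec ?_
      rintro _ ⟨y, rfl⟩
      simpa using pp x y
    simpa using congrArg (fun T => T v) this
  have : innerSL ℂ (insertPair i j θ v) ∘L insertPair i j φ = star c • innerSL ℂ v := by
    refine ContinuousLinearMap.ext_on dense_span_prodVec ?_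
    rintro _ ⟨x, rfl⟩
    have := congrArg star (pv x v)
    simpa [inner_conj_symm] using this
  have h1 := congrArg star (congrArg (fun T => T u) this)
  simpa [inner_conj_symm] using h1

theorem replacePair_self {M : ℕ} {G : Type*} {i j : Fin M} (φ : Fin M → G) :
    replacePair i j φ (φ i) (φ j) = φ := by
  simp [replacePair]

theorem pairOp_prodVec {i j : Fin N} (hij : i ≠ j)
    (B : TensorPower 2 H →L[ℂ] TensorPower 2 H)
    (hB : ∀ u v, inner ℂ (B u) (B v) = inner ℂ u v) (φ : Fin N → H) :
    pairOp i j B (prodVec φ) = insertPair i j φ (B (prodVec ![φ i, φ j])) := by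
  refine extendBounded_apply _ _ dense_span_prodVec 1 (fun a b => ?_) φ
  rw [inner_insertPair hij, hB, inner_prodVec, inner_prodVec, Fin.prod_univ_two]
  have := prod_replacePair hij a b (a i) (a j) (b i) (b j)
  rw [replacePair_self, replacePair_self] at this
  simp [this]

end PairOperators

section Swap

variable {H : Type u} [NormedAddCommGroup H] [InnerProductSpace ℂ H]

/-- The swap `V` on `H ⊗ H`, `V (x ⊗ y) = y ⊗ x`. -/
noncomputable def swapOp : TensorPower 2 H →L[ℂ] TensorPower 2 H :=
  extendBounded (prodVec (N := 2)) fun x => prodVec ![x 1, x 0]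

theorem swapOp_prodVec (x : Fin 2 → H) : swapOp (prodVec x) = prodVec ![x 1, x 0] := by
  refine extendBounded_apply _ _ dense_span_prodVec 1 (fun a b => ?_) x
  simp [inner_prodVec, Fin.prod_univ_two, mul_comm]

end Swap

/-! ## Hamiltonians, energy shells and the energy algebra -/

section Hamiltonian

variable {H : Type u} [NormedAddCommGroup H] [InnerProductSpace ℂ H]

/-- An (unbounded) operator `h` has compact resolvent: for some `z`, the operator `h - z` maps the
domain of `h` bijectively onto the space, with a compact inverse `R`. -/
def HasCompactResolvent (h : H →ₗ.[ℂ] H) : Prop :=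
  ∃ (z : ℂ) (R : H →L[ℂ] H), IsCompactOperator R ∧
    (∀ x : h.domain, R (h x - z • (x : H)) = x) ∧
    ∀ y : H, ∃ x : h.domain, (x : H) = R y ∧ h x - z • (x : H) = y

/-- The graph of the `N`-particle Hamiltonian `H_N = ∑ j, h_j`: the closure of the graph of the
operator `φ₁ ⊗ ⋯ ⊗ φ_N ↦ ∑ j, φ₁ ⊗ ⋯ ⊗ h φ_j ⊗ ⋯ ⊗ φ_N` on the span of the product vectors with
all factors in the domain of `h`.  So `(x, y)` belongs to it iff `x` is in the domain of `H_N`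
and `H_N x = y`. -/
noncomputable def hamiltonianGraph (N : ℕ) (h : H →ₗ.[ℂ] H) :
    Submodule ℂ (TensorPower N H × TensorPower N H) :=
  (Submodule.span ℂ (Set.range fun φ : Fin N → h.domain =>
    ((prodVec fun k => (φ k : H)),
      ∑ j, prodVec (Function.update (fun k => (φ k : H)) j (h (φ j)))))).topologicalClosure

theorem hamiltonianGraph_symmetric {N : ℕ} {h : H →ₗ.[ℂ] H}
    (hs : ∀ x y : h.domain, inner ℂ (h x) (y : H) = inner ℂ (x : H) (h y))
    {p q : TensorPower N H × TensorPower N H} (hp : p ∈ hamiltonianGraph N h)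
    (hq : q ∈ hamiltonianGraph N h) : inner ℂ p.2 q.1 = inner ℂ p.1 q.2 := by
  have base : ∀ φ θ : Fin N → h.domain,
      inner ℂ (∑ j, prodVec (Function.update (fun k => (φ k : H)) j (h (φ j))))
          (prodVec fun k => (θ k : H))
        = inner ℂ (prodVec fun k => (φ k : H))
          (∑ j, prodVec (Function.update (fun k => (θ k : H)) j (h (θ j)))) := by
    intro φ θ
    rw [sum_inner, inner_sum]
    refine Finset.sum_congr rfl fun j _ => ?_
    rw [inner_prodVec, inner_prodVec]
    refine Finset.prod_congr rfl fun k _ => ?_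
    by_cases hk : k = j
    · subst hk
      simpa using hs (φ k) (θ k)
    · simp [hk]
  have step : ∀ p : TensorPower N H × TensorPower N H,
      IsClosed {q : TensorPower N H × TensorPower N H | inner ℂ p.2 q.1 = inner ℂ p.1 q.2} :=
    fun p => isClosed_eq (by fun_prop) (by fun_prop)
  have step' : ∀ q : TensorPower N H × TensorPower N H,
      IsClosed {p : TensorPower N H × TensorPower N H | inner ℂ p.2 q.1 = inner ℂ p.1 q.2} :=
    fun q => isClosed_eq (by fun_prop) (by fun_prop)
  refine closure_minimal ?_ (step' q) hp
  intro p hp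
  refine closure_minimal ?_ (step p) hq
  intro q hq
  simp only [Set.mem_ofPred_eq]
  induction hp using Submodule.span_induction with
  | mem p hp =>
    obtain ⟨φ, rfl⟩ := hp
    induction hq using Submodule.span_induction with
    | mem q hq =>
      obtain ⟨θ, rfl⟩ := hq
      exact base φ θ
    | zero => simp
    | add x y _ _ hx hy => simp only [Prod.fst_add, Prod.snd_add, inner_add_right, hx, hy]
    | smul c x _ hx => simp only [Prod.smul_fst, Prod.smul_snd, inner_smul_right, hx]
  | zero => simp
  | add x y _ _ hx hy => simp only [Prod.fst_add, Prod.snd_add, inner_add_left, hx, hy]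
  | smul c x _ hx => simp only [Prod.smul_fst, Prod.smul_snd, inner_smul_left, hx]

/-- The graph of `H_N` is indeed the graph of an operator. -/
theorem hamiltonianGraph_functional {N : ℕ} {h : H →ₗ.[ℂ] H}
    (hd : Dense (h.domain : Set H))
    (hs : ∀ x y : h.domain, inner ℂ (h x) (y : H) = inner ℂ (x : H) (h y))
    {x y y' : TensorPower N H} (hy : (x, y) ∈ hamiltonianGraph N h)
    (hy' : (x, y') ∈ hamiltonianGraph N h) : y = y' := by
  have h0 : ((0 : TensorPower N H), y - y') ∈ hamiltonianGraph N h := by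
    simpa using Submodule.sub_mem _ hy hy'
  have h1 : ∀ φ : Fin N → H, inner ℂ (y - y') (prodVec φ) = 0 := by
    have hdp : Dense (Set.univ.pi fun _ : Fin N => (h.domain : Set H)) :=
      dense_pi Set.univ fun _ _ => hd
    have hcl : IsClosed {φ : Fin N → H | inner ℂ (y - y') (prodVec φ) = 0} :=
      isClosed_eq (continuous_const.inner continuous_prodVec) continuous_const
    intro φ
    refine closure_minimal ?_ hcl (hdp φ)
    intro φ hφ
    have hm := hamiltonianGraph_symmetric hs h0 (Submodule.le_topologicalClosure _
      (Submodule.subset_span ⟨fun k => (⟨φ k, hφ k (Set.mem_univ k)⟩ : h.domain), rfl⟩))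
    simpa using hm
  have h2 : innerSL ℂ (y - y') = 0 := by
    refine ContinuousLinearMap.ext_on dense_span_prodVec ?_
    rintro _ ⟨φ, rfl⟩
    exact h1 φ
  exact sub_eq_zero.mp (inner_self_eq_zero (𝕜 := ℂ).mp (congrArg (fun T => T (y - y')) h2))

/-- The eigenspace of `H_N` at the energy `E`. -/
noncomputable def energyShell (N : ℕ) (h : H →ₗ.[ℂ] H) (E : ℝ) :
    Submodule ℂ (TensorPower N H) :=
  (hamiltonianGraph N h).comap (LinearMap.id.prod ((E : ℂ) • LinearMap.id))

theorem isClosed_energyShell (N : ℕ) (h : H →ₗ.[ℂ] H) (E : ℝ) :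
    IsClosed (energyShell N h E : Set (TensorPower N H)) :=
  (Submodule.isClosed_topologicalClosure _).preimage
    (continuous_id.prodMk (continuous_const_smul (E : ℂ)))

instance (N : ℕ) (h : H →ₗ.[ℂ] H) (E : ℝ) : CompleteSpace (energyShell N h E) :=
  (isClosed_energyShell N h E).completeSpace_coe

/-- The energies, that is, the eigenvalues of `H_N`.  (When `h` is bounded below and has compact
resolvent, they form the whole spectrum of `H_N`; in any case `P_E = 0` for every other `E`.) -/
def energySpectrum (N : ℕ) (h : H →ₗ.[ℂ] H) : Set ℝ :=
  {E | energyShell N h E ≠ ⊥}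

/-- The energy algebra: the operators `f(H_N) = ∑ E, f(E) P_E`, `f` bounded on the spectrum,
where `P_E` is the orthogonal projection onto the energy shell at `E` (and where the sum converges
strongly). -/
def energyAlgebra (N : ℕ) (h : H →ₗ.[ℂ] H) : Set (TensorPower N H →L[ℂ] TensorPower N H) :=
  {A | ∃ f : energySpectrum N h → ℂ, (∃ M : ℝ, ∀ E, ‖f E‖ ≤ M) ∧
    ∀ x, HasSum (fun E : energySpectrum N h => f E • (energyShell N h E).starProjection x) (A x)}

end Hamiltonian

/-! ## Collision specifications -/

section Collisions

variable {H : Type u} [NormedAddCommGroup H] [InnerProductSpace ℂ H]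

/-- A collision specification `(C, U, ν)` for the single-particle Hamiltonian `h`.  Continuity of
`U` is meant in the strong operator topology, which is implied by continuity in norm. -/
structure CollisionSpecification (h : H →ₗ.[ℂ] H) (C : Type*) [MetricSpace C] [CompactSpace C]
    [MeasurableSpace C] [BorelSpace C] where
  /-- the unitary operators on `H ⊗ H` that describe the collisions -/
  U : C → unitary (TensorPower 2 H →L[ℂ] TensorPower 2 H)
  /-- the law of the collision parameter -/
  ν : Measure C
  continuous_U : ∀ x, Continuous fun σ => (U σ : TensorPower 2 H →L[ℂ] TensorPower 2 H) x
  injective_U : Function.Injective U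
  isProbabilityMeasure : IsProbabilityMeasure ν
  /-- `ν` charges every non-empty open set -/
  isOpenPosMeasure : ν.IsOpenPosMeasure
  /-- `U σ` commutes with `H_2`, that is, `(U σ) H_2 (U σ)* = H_2` as unbounded operators -/
  commute_hamiltonian : ∀ σ, ∀ p : TensorPower 2 H × TensorPower 2 H,
    ((U σ : TensorPower 2 H →L[ℂ] TensorPower 2 H) p.1,
      (U σ : TensorPower 2 H →L[ℂ] TensorPower 2 H) p.2) ∈ hamiltonianGraph 2 h ↔
      p ∈ hamiltonianGraph 2 h
  exists_trivial : ∃ σ₀, U σ₀ = 1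
  /-- the family of the `U σ` is closed under adjoints, and the map `τ` of `C` with
  `(U σ)* = U (τ σ)` is measurable and leaves `ν` invariant -/
  reversible : ∃ τ : C → C, (∀ σ, star (U σ) = U (τ σ)) ∧ MeasurePreserving τ ν ν
  /-- the family of the `U σ` is closed under conjugation by the swap `V = V*`, and the map `τ`
  of `C` with `V (U σ) V* = U (τ σ)` is measurable and leaves `ν` invariant -/
  swap_symmetric : ∃ τ : C → C,
    (∀ σ, (swapOp ∘L (U σ : TensorPower 2 H →L[ℂ] TensorPower 2 H)) ∘L swapOp.adjoint
      = (U (τ σ) : TensorPower 2 H →L[ℂ] TensorPower 2 H)) ∧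
      MeasurePreserving τ ν ν

namespace CollisionSpecification

variable {h : H →ₗ.[ℂ] H} {C : Type*} [MetricSpace C] [CompactSpace C] [MeasurableSpace C]
  [BorelSpace C]

/-- The specification is (2-)ergodic: the commutant of the operators `U σ` on `H ⊗ H` is the
energy algebra of two particles. -/
def IsErgodic (S : CollisionSpecification h C) : Prop :=
  (Set.range fun σ => (S.U σ : TensorPower 2 H →L[ℂ] TensorPower 2 H)).centralizer
    = energyAlgebra 2 h

/-- The commutant of all operators `U_{i,j}(σ)`, `i < j`, on `H^{⊗N}`. -/
noncomputable def commutant (S : CollisionSpecification h C) (N : ℕ) :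
    Subalgebra ℂ (TensorPower N H →L[ℂ] TensorPower N H) :=
  Subalgebra.centralizer ℂ
    {T | ∃ (i j : Fin N) (σ : C), i < j ∧ T = pairOp i j (S.U σ)}

end CollisionSpecification

end Collisions

end QuantumKac

/-! The proof reduces the N-body statement to the two-body hypothesis by slicing. Fix a pair `i < j`
and freeze the other factors, as in `φ` on the left and as in `θ` on the right. The matrix elements
of `A` then form an operator `(insertPair i j φ)* A (insertPair i j θ)` on `H ⊗ H`. If `A` commutes
with every `U_{i,j}(σ)`, this slice commutes with every `U σ` (`slice_commute`), so ergodicity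
places it in the two-particle energy algebra. There it acts as a scalar on each energy shell
(`exists_eq_smul_of_mem_energyAlgebra`), hence on each `ψ_a ⊗ ψ_b`.

Consequently `⟪Ψ_α, A Ψ_β⟫ = 0` as soon as `α` and `β` differ at `i` or at `j`
(`inner_apply_eq_zero`). As `N ≥ 2`, every index belongs to some pair, so all off-diagonal matrix
elements vanish.

Commutativity follows by diagonalizing two operators in one product basis. The required eigenbasis
of `h` comes from the compact resolvent: moved to a real point it is compact and symmetric, and the
spectral theorem applies (`HasCompactResolvent.exists_eigenbasis`). -/

namespace QuantumKac

universe u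

/-! ### Product vectors: multilinearity, totality, orthonormality -/

section ProductVectors

variable {N : ℕ} {H : Type u} [NormedAddCommGroup H] [InnerProductSpace ℂ H]

theorem prodVec_update_add (φ : Fin N → H) (k : Fin N) (x y : H) :
    prodVec (Function.update φ k (x + y))
      = prodVec (Function.update φ k x) + prodVec (Function.update φ k y) := by
  simp only [prodVec, MultilinearMap.map_update_add, UniformSpace.Completion.coe_add]

theorem prodVec_update_smul (φ : Fin N → H) (k : Fin N) (c : ℂ) (x : H) :
    prodVec (Function.update φ k (c • x)) = c • prodVec (Function.update φ k x) := by
  simp only [prodVec, MultilinearMap.map_update_smul, UniformSpace.Completion.coe_smul]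

/-- The elementary tensor as a continuous linear function of its `k`th factor. -/
noncomputable def prodVecFactor (φ : Fin N → H) (k : Fin N) : H →L[ℂ] TensorPower N H where
  toFun x := prodVec (Function.update φ k x)
  map_add' := prodVec_update_add φ k
  map_smul' := prodVec_update_smul φ k
  cont := continuous_prodVec.comp (continuous_const.update k continuous_id)

theorem prodVecFactor_apply (φ : Fin N → H) (k : Fin N) (x : H) :
    prodVecFactor φ k x = prodVec (Function.update φ k x) := rfl

theorem eq_zero_of_inner_prodVec {v : TensorPower N H}
    (hv : ∀ φ : Fin N → H, inner ℂ v (prodVec φ) = 0) : v = 0 := by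
  have h2 : innerSL ℂ v = 0 := by
    refine ContinuousLinearMap.ext_on dense_span_prodVec ?_
    rintro _ ⟨φ, rfl⟩
    exact hv φ
  exact inner_self_eq_zero (𝕜 := ℂ).mp (congrArg (fun T => T v) h2)

/-- Product vectors whose factors belong to a total family are total in the tensor power. -/
theorem eq_zero_of_inner_prodVec_of_dense {J : Type*} {ψ : J → H}
    (hψ : Dense (Submodule.span ℂ (Set.range ψ) : Set H)) {v : TensorPower N H}
    (hv : ∀ α : Fin N → J, inner ℂ v (prodVec fun k => ψ (α k)) = 0) : v = 0 := by
  -- Factors indexed by `s` are arbitrary, the others still come from the family. Each induction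
  -- step frees one factor, by linearity and continuity in that factor.
  have key : ∀ (s : Finset (Fin N)) (φ : Fin N → H), (∀ k ∉ s, φ k ∈ Set.range ψ) →
      inner ℂ v (prodVec φ) = 0 := by
    intro s
    induction s using Finset.induction_on with
    | empty =>
      intro φ hφ
      choose α hα using fun k => hφ k (Finset.notMem_empty k)
      obtain rfl : (fun k => ψ (α k)) = φ := funext hα
      exact hv α
    | insert k s hk ih =>
      intro φ hφ
      have h0 : innerSL ℂ v ∘L prodVecFactor φ k = 0 := by
        refine ContinuousLinearMap.ext_on hψ ?_
        rintro _ ⟨j, rfl⟩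
        refine ih _ fun l hl => ?_
        rcases eq_or_ne l k with rfl | hlk
        · simp
        · simpa [hlk] using hφ l (by simp [hlk, hl])
      simpa [prodVecFactor_apply] using congrArg (fun T => T (φ k)) h0
  exact eq_zero_of_inner_prodVec fun φ => key Finset.univ φ (by simp)

theorem dense_span_prodVec_of_dense {J : Type*} {ψ : J → H}
    (hψ : Dense (Submodule.span ℂ (Set.range ψ) : Set H)) :
    Dense (Submodule.span ℂ (Set.range fun α : Fin N → J => prodVec fun k => ψ (α k)) :
      Set (TensorPower N H)) := by
  rw [Submodule.dense_iff_topologicalClosure_eq_top, Submodule.topologicalClosure_eq_top_iff,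
    eq_bot_iff]
  intro v hv
  exact eq_zero_of_inner_prodVec_of_dense hψ fun α =>
    (Submodule.mem_orthogonal' _ v).mp hv _ (Submodule.subset_span ⟨α, rfl⟩)

theorem orthonormal_prodVec {J : Type*} {ψ : J → H} (hψ : Orthonormal ℂ ψ) :
    Orthonormal ℂ fun α : Fin N → J => prodVec fun k => ψ (α k) := by
  classical
  rw [orthonormal_iff_ite]
  intro α β
  rw [inner_prodVec]
  simp only [orthonormal_iff_ite.mp hψ]
  split_ifs with hαβ
  · simp [hαβ]
  · obtain ⟨k, hk⟩ := Function.ne_iff.mp hαβ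
    exact Finset.prod_eq_zero (Finset.mem_univ k) (if_neg hk)

end ProductVectors

/-! ### Two-particle slices of an operator on the tensor power -/

section Slices

variable {N : ℕ} {H : Type u} [NormedAddCommGroup H] [InnerProductSpace ℂ H]

/-- Insertion overwrites the factors `i` and `j`, so it cannot see what the background has there. -/
theorem insertPair_replacePair {i j : Fin N} (hij : i ≠ j) (φ : Fin N → H) (x y : H) :
    insertPair i j (replacePair i j φ x y) = insertPair i j φ := by
  refine ContinuousLinearMap.ext_on dense_span_prodVec ?_
  rintro _ ⟨z, rfl⟩
  rw [insertPair_prodVec hij, insertPair_prodVec hij]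
  congr 1
  funext k
  by_cases hj : k = j
  · simp [replacePair, hj]
  · by_cases hi : k = i <;> simp [replacePair, hi, hj, hij]

theorem pairOp_insertPair {i j : Fin N} (hij : i ≠ j)
    (B : TensorPower 2 H →L[ℂ] TensorPower 2 H)
    (hB : ∀ u v, inner ℂ (B u) (B v) = inner ℂ u v) (φ : Fin N → H) (u : TensorPower 2 H) :
    pairOp i j B (insertPair i j φ u) = insertPair i j φ (B u) := by
  have h0 : pairOp i j B ∘L insertPair i j φ = insertPair i j φ ∘L B := by
    refine ContinuousLinearMap.ext_on dense_span_prodVec ?_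
    rintro _ ⟨x, rfl⟩
    simp only [ContinuousLinearMap.comp_apply]
    rw [insertPair_prodVec hij, pairOp_prodVec hij B hB, insertPair_replacePair hij]
    congr 3
    funext k
    fin_cases k <;> simp [replacePair, hij]
  exact congrArg (fun T => T u) h0

/-- The counterpart of `pairOp_insertPair` for the left argument of a matrix element. The adjoint is
taken on `H ⊗ H`, through `inner_insertPair`. This avoids `pairOp` of `B.adjoint`, which need not be
isometric, as `pairOp_prodVec` would demand. -/
theorem inner_pairOp_insertPair {i j : Fin N} (hij : i ≠ j)
    (B : TensorPower 2 H →L[ℂ] TensorPower 2 H)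
    (hB : ∀ u v, inner ℂ (B u) (B v) = inner ℂ u v) (φ : Fin N → H) (u : TensorPower 2 H)
    (a : TensorPower N H) :
    inner ℂ (insertPair i j φ u) (pairOp i j B a)
      = inner ℂ (insertPair i j φ (B.adjoint u)) a := by
  have h0 : innerSL ℂ (insertPair i j φ u) ∘L pairOp i j B
      = innerSL ℂ (insertPair i j φ (B.adjoint u)) := by
    refine ContinuousLinearMap.ext_on dense_span_prodVec ?_
    rintro _ ⟨θ, rfl⟩
    have hθ : prodVec θ = insertPair i j θ (prodVec ![θ i, θ j]) := by
      rw [insertPair_prodVec hij]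
      simp [replacePair_self]
    simp only [ContinuousLinearMap.comp_apply, innerSL_apply_apply]
    rw [pairOp_prodVec hij B hB, inner_insertPair hij, hθ, inner_insertPair hij,
      ContinuousLinearMap.adjoint_inner_left]
  exact congrArg (fun T => T a) h0

/-- The two-particle matrix elements of an operator on `H^{⊗N}` that commutes with `B_{i,j}`
commute with `B`. -/
theorem slice_commute {i j : Fin N} (hij : i ≠ j)
    (B : TensorPower 2 H →L[ℂ] TensorPower 2 H)
    (hB : ∀ u v, inner ℂ (B u) (B v) = inner ℂ u v)
    (A : TensorPower N H →L[ℂ] TensorPower N H) (hA : pairOp i j B * A = A * pairOp i j B)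
    (φ θ : Fin N → H) :
    B * ((insertPair i j φ).adjoint ∘L A ∘L insertPair i j θ)
      = ((insertPair i j φ).adjoint ∘L A ∘L insertPair i j θ) * B := by
  ext v
  refine ext_inner_left ℂ fun u => ?_
  simp only [mul_apply_eq_comp, ContinuousLinearMap.comp_apply]
  -- Both sides become matrix elements between `insertPair i j φ u` and `insertPair i j θ v`, of
  -- `B_{i,j} A` on the left and of `A B_{i,j}` on the right.
  rw [← ContinuousLinearMap.adjoint_inner_left B, ContinuousLinearMap.adjoint_inner_right,
    ContinuousLinearMap.adjoint_inner_right, ← pairOp_insertPair hij B hB,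
    ← inner_pairOp_insertPair hij B hB]
  exact congrArg (fun T => inner ℂ (insertPair i j φ u) (T (insertPair i j θ v))) hA

end Slices

/-! ### Energy shells and the action of the energy algebra on them -/

section Energy

variable {H : Type u} [NormedAddCommGroup H] [InnerProductSpace ℂ H]

theorem prodVec_mem_energyShell {N : ℕ} {h : H →ₗ.[ℂ] H} {φ : Fin N → H} {e : Fin N → ℝ}
    (hφ : ∀ k, ∃ hk : φ k ∈ h.domain, h ⟨φ k, hk⟩ = (e k : ℂ) • φ k) :
    prodVec φ ∈ energyShell N h (∑ k, e k) := by
  choose hd he using hφ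
  have hm : ((prodVec φ, ∑ j, prodVec (Function.update φ j (h ⟨φ j, hd j⟩))) :
      TensorPower N H × TensorPower N H) ∈ hamiltonianGraph N h :=
    Submodule.le_topologicalClosure _ (Submodule.subset_span ⟨fun k => ⟨φ k, hd k⟩, rfl⟩)
  have hs : ∑ j, prodVec (Function.update φ j (h ⟨φ j, hd j⟩))
      = ((∑ k, e k : ℝ) : ℂ) • prodVec φ := by
    push_cast
    rw [Finset.sum_smul]
    exact Finset.sum_congr rfl fun j _ => by
      rw [he, prodVec_update_smul, Function.update_eq_self]
  rwa [hs] at hm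

theorem inner_eq_zero_of_mem_energyShell {N : ℕ} {h : H →ₗ.[ℂ] H}
    (hs : ∀ x y : h.domain, inner ℂ (h x) (y : H) = inner ℂ (x : H) (h y))
    {E F : ℝ} (hEF : E ≠ F) {x y : TensorPower N H} (hx : x ∈ energyShell N h E)
    (hy : y ∈ energyShell N h F) : inner ℂ x y = 0 := by
  have key : inner ℂ ((E : ℂ) • x) y = inner ℂ x ((F : ℂ) • y) :=
    hamiltonianGraph_symmetric hs hx hy
  rw [inner_smul_left, inner_smul_right, Complex.conj_ofReal] at key
  have : ((E : ℂ) - F) * inner ℂ x y = 0 := by rw [sub_mul, key, sub_self]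
  refine (mul_eq_zero.mp this).resolve_left ?_
  exact sub_ne_zero.mpr (by exact_mod_cast hEF)

/-- Shells at different energies are orthogonal, so on a vector of one shell the defining series has
a single nonzero term. -/
theorem exists_eq_smul_of_mem_energyAlgebra {N : ℕ} {h : H →ₗ.[ℂ] H}
    (hs : ∀ x y : h.domain, inner ℂ (h x) (y : H) = inner ℂ (x : H) (h y))
    {A : TensorPower N H →L[ℂ] TensorPower N H} (hA : A ∈ energyAlgebra N h)
    {E : ℝ} {x : TensorPower N H} (hx : x ∈ energyShell N h E) : ∃ c : ℂ, A x = c • x := by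
  -- For `x = 0` the number `E` need not be an eigenvalue, and `f` then has no value there.
  rcases eq_or_ne x 0 with rfl | hx0
  · exact ⟨0, by simp⟩
  obtain ⟨f, -, hf⟩ := hA
  have hE : E ∈ energySpectrum N h := fun hbot => hx0 (by rwa [hbot, Submodule.mem_bot] at hx)
  refine ⟨f ⟨E, hE⟩, (hf x).unique ?_⟩
  have h1 := hasSum_single (f := fun E : energySpectrum N h =>
    f E • (energyShell N h E).starProjection x) ⟨E, hE⟩ ?_
  · simpa only [Submodule.starProjection_eq_self_iff.mpr hx] using h1
  · intro F hF
    have : (energyShell N h F).starProjection x = 0 := by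
      rw [Submodule.starProjection_apply_eq_zero_iff, Submodule.mem_orthogonal]
      exact fun y hy => inner_eq_zero_of_mem_energyShell hs (fun hne => hF (Subtype.ext hne)) hy hx
    simp [this]

end Energy

/-! ### Vanishing of the off-diagonal matrix elements -/

section Diagonal

variable {H : Type u} [NormedAddCommGroup H] [InnerProductSpace ℂ H]

theorem symmetric_of_isSelfAdjoint [CompleteSpace H] {h : H →ₗ.[ℂ] H} (hsa : IsSelfAdjoint h)
    (x y : h.domain) : inner ℂ (h x) (y : H) = inner ℂ (x : H) (h y) := by
  have hf := LinearPMap.adjoint_isFormalAdjoint hsa.dense_domain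
  rw [LinearPMap.isSelfAdjoint_def.mp hsa] at hf
  exact hf x y

variable {h : H →ₗ.[ℂ] H} {C : Type*} [MetricSpace C] [CompactSpace C] [MeasurableSpace C]
  [BorelSpace C]

namespace CollisionSpecification

theorem inner_U (S : CollisionSpecification h C) (σ : C) (u v : TensorPower 2 H) :
    inner ℂ ((S.U σ : TensorPower 2 H →L[ℂ] TensorPower 2 H) u)
      ((S.U σ : TensorPower 2 H →L[ℂ] TensorPower 2 H) v) = inner ℂ u v := by
  rw [← ContinuousLinearMap.adjoint_inner_right, ← ContinuousLinearMap.star_eq_adjoint,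
    ← mul_apply_eq_comp, Unitary.coe_star_mul_self, one_apply_eq_self]

/-- The matrix element is that of a two-particle slice between `ψ_{α i} ⊗ ψ_{α j}` and `ψ_{β i} ⊗
ψ_{β j}`. The slice multiplies the latter by a scalar, and the two vectors are orthogonal. -/
theorem inner_apply_eq_zero (S : CollisionSpecification h C)
    (hs : ∀ x y : h.domain, inner ℂ (h x) (y : H) = inner ℂ (x : H) (h y))
    (hS : S.IsErgodic) {N : ℕ} {J : Type*} {ψ : J → H} (hψ : Orthonormal ℂ ψ) {e : J → ℝ}
    (he : ∀ j, ∃ hj : ψ j ∈ h.domain, h ⟨ψ j, hj⟩ = (e j : ℂ) • ψ j)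
    {A : TensorPower N H →L[ℂ] TensorPower N H} (hA : A ∈ S.commutant N)
    {α β : Fin N → J} {i j : Fin N} (hij : i < j) (hαβ : α i ≠ β i ∨ α j ≠ β j) :
    inner ℂ (prodVec fun k => ψ (α k)) (A (prodVec fun k => ψ (β k))) = 0 := by
  set φ : Fin N → H := fun k => ψ (α k)
  set θ : Fin N → H := fun k => ψ (β k)
  have hself : ∀ φ : Fin N → H, prodVec φ = insertPair i j φ (prodVec ![φ i, φ j]) := by
    intro φ
    rw [insertPair_prodVec hij.ne]
    simp [replacePair_self]
  have hmem : (insertPair i j φ).adjoint ∘L A ∘L insertPair i j θ ∈ energyAlgebra 2 h := by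
    rw [← hS, Set.mem_centralizer_iff]
    rintro _ ⟨σ, rfl⟩
    refine slice_commute hij.ne _ (S.inner_U σ) A ?_ φ θ
    exact Subalgebra.mem_centralizer_iff ℂ |>.mp hA _ ⟨i, j, σ, hij, rfl⟩
  have hshell : prodVec ![θ i, θ j] ∈ energyShell 2 h (∑ k, (![e (β i), e (β j)] : Fin 2 → ℝ) k) := by
    refine prodVec_mem_energyShell fun k => ?_
    fin_cases k
    · exact he (β i)
    · exact he (β j)
  obtain ⟨c, hc⟩ := exists_eq_smul_of_mem_energyAlgebra hs hmem hshell
  rw [hself φ, hself θ, ← ContinuousLinearMap.adjoint_inner_right]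
  change inner ℂ (prodVec ![φ i, φ j])
    (((insertPair i j φ).adjoint ∘L A ∘L insertPair i j θ) (prodVec ![θ i, θ j])) = 0
  rw [hc, inner_smul_right, inner_prodVec, Fin.prod_univ_two]
  rcases hαβ with hne | hne
  · simp [φ, θ, hψ.2 hne]
  · simp [φ, θ, hψ.2 hne]

/-- Every operator that commutes with all the collisions is diagonal in a product basis of
eigenvectors of `h`. -/
theorem exists_apply_prodVec_eq_smul (S : CollisionSpecification h C)
    (hs : ∀ x y : h.domain, inner ℂ (h x) (y : H) = inner ℂ (x : H) (h y))
    (hS : S.IsErgodic) {N : ℕ} (hN : 2 ≤ N) {J : Type*} {ψ : J → H} (hψ : Orthonormal ℂ ψ)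
    (hd : Dense (Submodule.span ℂ (Set.range ψ) : Set H)) {e : J → ℝ}
    (he : ∀ j, ∃ hj : ψ j ∈ h.domain, h ⟨ψ j, hj⟩ = (e j : ℂ) • ψ j)
    {A : TensorPower N H →L[ℂ] TensorPower N H} (hA : A ∈ S.commutant N) (β : Fin N → J) :
    ∃ c : ℂ, A (prodVec fun k => ψ (β k)) = c • prodVec fun k => ψ (β k) := by
  set Ψ : (Fin N → J) → TensorPower N H := fun α => prodVec fun k => ψ (α k) with hΨ
  have ho : Orthonormal ℂ Ψ := orthonormal_prodVec hψ
  -- The eigenvalue can only be the diagonal matrix element; the difference is shown orthogonal to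
  -- every `Ψ α`.
  refine ⟨inner ℂ (Ψ β) (A (Ψ β)), sub_eq_zero.mp (eq_zero_of_inner_prodVec_of_dense hd ?_)⟩
  intro α
  change inner ℂ _ (Ψ α) = 0
  rw [inner_eq_zero_symm, inner_sub_right, inner_smul_right]
  rcases eq_or_ne α β with rfl | hαβ
  · rw [inner_self_eq_norm_sq_to_K, ho.1]
    simp [hΨ]
  · rw [ho.2 hαβ, mul_zero, sub_zero]
    obtain ⟨k, hk⟩ := Function.ne_iff.mp hαβ
    -- Here `N ≥ 2` is essential: it gives a partner `l` for the index `k` at which `α` and `β`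
    -- differ.
    have : Nontrivial (Fin N) := Fin.nontrivial_iff_two_le.mpr hN
    obtain ⟨l, hl⟩ := exists_ne k
    rcases lt_or_gt_of_ne hl with hlt | hlt
    · exact S.inner_apply_eq_zero hs hS hψ he hA hlt (Or.inr hk)
    · exact S.inner_apply_eq_zero hs hS hψ he hA hlt (Or.inl hk)

end CollisionSpecification

end Diagonal

/-! ### A Hilbert basis of eigenvectors from the compact resolvent -/

section Eigenbasis

variable {H : Type u} [NormedAddCommGroup H] [InnerProductSpace ℂ H]

/-- A symmetric operator on a separable space has at most countably many eigenvalues. -/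
theorem countable_eigenvalues [TopologicalSpace.SeparableSpace H] {h : H →ₗ.[ℂ] H}
    (hs : ∀ x y : h.domain, inner ℂ (h x) (y : H) = inner ℂ (x : H) (h y)) :
    {l : ℝ | ∃ x : h.domain, x ≠ 0 ∧ h x = (l : ℂ) • (x : H)}.Countable := by
  set s := {l : ℝ | ∃ x : h.domain, x ≠ 0 ∧ h x = (l : ℂ) • (x : H)}
  have hu : ∀ l : s, ∃ x : h.domain, ‖(x : H)‖ = 1 ∧ h x = ((l : ℝ) : ℂ) • (x : H) := by
    rintro ⟨l, x, hx, hl⟩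
    have hx' : ‖(x : H)‖ ≠ 0 := by simpa using hx
    refine ⟨((‖(x : H)‖⁻¹ : ℝ) : ℂ) • x, ?_, ?_⟩
    · rw [Submodule.coe_smul, norm_smul, Complex.norm_real, norm_inv, norm_norm,
        inv_mul_cancel₀ hx']
    · rw [LinearPMap.map_smul, Submodule.coe_smul, smul_comm (l : ℂ)]
      exact congrArg _ hl
  choose v hv1 hv using hu
  -- Unit eigenvectors for distinct eigenvalues are orthogonal, hence at distance `√2 ≥ 1/2 + 1/2`.
  -- A separable space has only countably many disjoint nonempty open balls.
  have hd : Pairwise (Function.onFun Disjoint fun l : s => Metric.ball (v l : H) (1 / 2)) := by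
    intro l m hlm
    refine Metric.ball_disjoint_ball ?_
    have h0 : inner ℂ (v l : H) (v m : H) = 0 := by
      have key := hs (v l) (v m)
      rw [hv, hv, inner_smul_left, inner_smul_right, Complex.conj_ofReal] at key
      have hz : (((l : ℝ) : ℂ) - (m : ℝ)) * inner ℂ (v l : H) (v m : H) = 0 := by
        rw [sub_mul, key, sub_self]
      refine (mul_eq_zero.mp hz).resolve_left ?_
      exact sub_ne_zero.mpr (by exact_mod_cast fun hne => hlm (Subtype.ext hne))
    have h1 := norm_sub_sq (𝕜 := ℂ) (v l : H) (v m : H)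
    rw [h0, hv1, hv1] at h1
    simp only [map_zero] at h1
    rw [dist_eq_norm]
    nlinarith [norm_nonneg ((v l : H) - v m)]
  exact Set.countable_coe_iff.mp (hd.countable_of_isOpen_disjoint
    (fun _ => Metric.isOpen_ball) fun l => ⟨v l, Metric.mem_ball_self (by norm_num)⟩)

/-- A symmetric operator with compact resolvent on a separable Hilbert space has a compact
resolvent at some real point. -/
theorem HasCompactResolvent.exists_real [CompleteSpace H] [TopologicalSpace.SeparableSpace H]
    {h : H →ₗ.[ℂ] H} (hres : HasCompactResolvent h)
    (hs : ∀ x y : h.domain, inner ℂ (h x) (y : H) = inner ℂ (x : H) (h y)) :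
    ∃ (l : ℝ) (T : H →L[ℂ] H), IsCompactOperator T ∧
      ∀ y : H, ∃ x : h.domain, (x : H) = T y ∧ h x - (l : ℂ) • (x : H) = y := by
  obtain ⟨z, R, hR, -, hR2⟩ := hres
  obtain ⟨l, hl⟩ : ∃ l : ℝ, ¬ ∃ x : h.domain, x ≠ 0 ∧ h x = (l : ℂ) • (x : H) := by
    by_contra! hall
    exact Cardinal.not_countable_real ((countable_eigenvalues hs).mono fun l _ => hall l)
  -- On the domain, `h - l = (1 - w R)(h - z)`, so the resolvent at `l` should be `R (1 - w R)⁻¹`.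
  set w : ℂ := l - z with hw
  have hunit : IsUnit (1 - w • R) := by
    rcases eq_or_ne w 0 with h0 | h0
    · simp [h0]
    -- An eigenvector of `R` at `w⁻¹` would be one of `h` at `z + w = l`. The Fredholm alternative
    -- for the compact `R` then makes `w⁻¹ - R` invertible.
    have hne : ¬ Module.End.HasEigenvalue (R : Module.End ℂ H) w⁻¹ := by
      intro hev
      obtain ⟨x, hx⟩ := hev.exists_hasEigenvector
      have hRx : R x = w⁻¹ • x := hx.apply_eq_smul
      obtain ⟨y, hy, hyx⟩ := hR2 x
      have hxy : x = w • (y : H) := by rw [hy, hRx, smul_inv_smul₀ h0]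
      refine hl ⟨y, ?_, ?_⟩
      · rintro rfl
        exact hx.2 (by simpa using hxy)
      · have : h y = z • (y : H) + w • (y : H) := by rw [← hxy, ← hyx]; abel
        rw [this, ← add_smul, hw, add_sub_cancel]
    have hr := (hR.hasEigenvalue_or_mem_resolventSet (inv_ne_zero h0)).resolve_left hne
    rw [spectrum.mem_resolventSet_iff] at hr
    have h2 : 1 - w • R = (Units.mk0 w h0) • (algebraMap ℂ (H →L[ℂ] H) w⁻¹ - R) := by
      rw [Units.smul_mk0, smul_sub, Algebra.algebraMap_eq_smul_one, smul_inv_smul₀ h0]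
    rw [h2]
    exact hr.smul _
  obtain ⟨Q, hQ⟩ := hunit
  refine ⟨l, R ∘L (↑Q⁻¹ : H →L[ℂ] H), hR.comp_clm _, fun y => ?_⟩
  have hy : (1 - w • R) ((↑Q⁻¹ : H →L[ℂ] H) y) = y := by
    rw [← hQ, ← mul_apply_eq_comp, Units.mul_inv, one_apply_eq_self]
  obtain ⟨x, hx, hxy⟩ := hR2 ((↑Q⁻¹ : H →L[ℂ] H) y)
  refine ⟨x, hx, ?_⟩
  have hy' : (↑Q⁻¹ : H →L[ℂ] H) y - w • (x : H) = y := by rw [hx]; simpa using hy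
  rw [← hy', ← hxy, hw, sub_smul]
  abel

/-- A compact symmetric operator on a Hilbert space has a Hilbert basis of eigenvectors. -/
theorem exists_hilbertBasis_eigenvectors [CompleteSpace H] {T : H →L[ℂ] H}
    (hT : IsCompactOperator T) (hsymm : T.IsSymmetric) :
    ∃ (J : Type u) (ψ : HilbertBasis J ℂ H) (μ : J → ℂ), ∀ j, T (ψ j) = μ j • ψ j := by
  have hclosed : ∀ μ : ℂ, CompleteSpace (Module.End.eigenspace (T : Module.End ℂ H) μ) := fun μ =>
    (ContinuousLinearMap.isClosed_eigenspace T μ).completeSpace_coe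
  -- All complex `μ` are allowed, including `0`; the basis is empty when `μ` is not an eigenvalue.
  choose w b hb using fun μ : ℂ =>
    exists_hilbertBasis ℂ (Module.End.eigenspace (T : Module.End ℂ H) μ)
  have hv : Orthonormal ℂ fun a : Σ μ : ℂ, w μ => (b a.1 a.2 : H) :=
    hsymm.orthogonalFamily_eigenspaces.orthonormal_sigma_orthonormal fun μ => (b μ).orthonormal
  have hbot : (Submodule.span ℂ (Set.range fun a : Σ μ : ℂ, w μ => (b a.1 a.2 : H)))ᗮ = ⊥ := by
    rw [eq_bot_iff, ← T.orthogonalComplement_iSup_eigenspaces_eq_bot hT hsymm,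
      ← Submodule.iInf_orthogonal]
    refine le_iInf fun μ y hy => (Submodule.mem_orthogonal' _ y).mpr fun x hx => ?_
    have h0 : innerSL ℂ y ∘L (Module.End.eigenspace (T : Module.End ℂ H) μ).subtypeL = 0 := by
      refine ContinuousLinearMap.ext_on
        (Submodule.dense_iff_topologicalClosure_eq_top.mpr (b μ).dense_span) ?_
      rintro _ ⟨k, rfl⟩
      exact (Submodule.mem_orthogonal' _ y).mp hy _ (Submodule.subset_span ⟨⟨μ, k⟩, rfl⟩)
    exact congrArg (fun L => L ⟨x, hx⟩) h0
  refine ⟨_, HilbertBasis.mkOfOrthogonalEqBot hv hbot, fun a => a.1, fun a => ?_⟩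
  rw [HilbertBasis.coe_mkOfOrthogonalEqBot]
  exact Module.End.mem_eigenspace_iff.mp (b a.1 a.2).2

/-- A symmetric operator with compact resolvent on a separable Hilbert space has a Hilbert basis
of eigenvectors. -/
theorem HasCompactResolvent.exists_eigenbasis [CompleteSpace H]
    [TopologicalSpace.SeparableSpace H] {h : H →ₗ.[ℂ] H} (hres : HasCompactResolvent h)
    (hs : ∀ x y : h.domain, inner ℂ (h x) (y : H) = inner ℂ (x : H) (h y)) :
    ∃ (J : Type u) (ψ : HilbertBasis J ℂ H) (e : J → ℝ),
      ∀ j, ∃ hj : ψ j ∈ h.domain, h ⟨ψ j, hj⟩ = (e j : ℂ) • ψ j := by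
  obtain ⟨l, T, hT, hT2⟩ := hres.exists_real hs
  -- `T` inherits symmetry from `h - l` because `l` is real.
  have hsymm : T.IsSymmetric := by
    intro a b
    obtain ⟨x, hx, hxa⟩ := hT2 a
    obtain ⟨y, hy, hyb⟩ := hT2 b
    change inner ℂ (T a) b = inner ℂ a (T b)
    rw [← hx, ← hy, ← hxa, ← hyb, inner_sub_left, inner_sub_right, hs, inner_smul_left,
      inner_smul_right, Complex.conj_ofReal]
  obtain ⟨J, ψ, μ, hψ⟩ := exists_hilbertBasis_eigenvectors hT hsymm
  -- From `T ψ = μ ψ` follows `(h - l) (μ ψ) = ψ`, whence the eigenvalue `l + μ⁻¹`. The real part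
  -- loses nothing, as `μ` is real.
  refine ⟨J, ψ, fun j => l + ((μ j)⁻¹).re, fun j => ?_⟩
  have hx0 : ψ j ≠ 0 := ψ.orthonormal.ne_zero j
  have hreal : (starRingEnd ℂ) (μ j) = μ j :=
    hsymm.conj_eigenvalue_eq_self (Module.End.hasEigenvalue_of_hasEigenvector
      ⟨Module.End.mem_eigenspace_iff.mpr (hψ j), hx0⟩)
  obtain ⟨y, hy, hyx⟩ := hT2 (ψ j)
  -- `T` is injective, being a right inverse of `h - l`.
  have hμ : μ j ≠ 0 := by
    intro h0
    have hy0 : y = 0 := Subtype.ext (by rw [hy, hψ, h0]; simp)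
    rw [hy0] at hyx
    exact hx0 (by simpa using hyx.symm)
  have hxy : ψ j = (((μ j)⁻¹ • y : h.domain) : H) := by
    rw [Submodule.coe_smul, hy, hψ, inv_smul_smul₀ hμ]
  have hdom : ψ j ∈ h.domain := hxy ▸ ((μ j)⁻¹ • y).2
  refine ⟨hdom, ?_⟩
  have hx' : (⟨ψ j, hdom⟩ : h.domain) = (μ j)⁻¹ • y := Subtype.ext hxy
  have hre : ((((μ j)⁻¹).re : ℝ) : ℂ) = (μ j)⁻¹ := by
    rw [← Complex.conj_eq_iff_re, map_inv₀, hreal]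
  have hy' : h y = ψ j + (l : ℂ) • (y : H) := by rw [← hyx]; abel
  rw [hx', LinearPMap.map_smul, hy', Complex.ofReal_add, hre, smul_add, add_smul,
    smul_comm _ (l : ℂ), ← Submodule.coe_smul, ← hxy, add_comm]

end Eigenbasis

end QuantumKac

/-! ### Diagonality and commutativity of the commutant -/

theorem theorem2p9 {H : Type*} [NormedAddCommGroup H] [InnerProductSpace ℂ H] [CompleteSpace H]
    [TopologicalSpace.SeparableSpace H]
    (h : H →ₗ.[ℂ] H) (hsa : IsSelfAdjoint h) (hres : QuantumKac.HasCompactResolvent h)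
    {C : Type*} [MetricSpace C] [CompactSpace C] [MeasurableSpace C] [BorelSpace C]
    (S : QuantumKac.CollisionSpecification h C) (hS : S.IsErgodic) (N : ℕ) (hN : 2 ≤ N) :
    (∀ A ∈ S.commutant N, ∀ B ∈ S.commutant N, A * B = B * A) ∧
      ∀ (J : Type*) (ψ : HilbertBasis J ℂ H) (e : J → ℝ),
        (∀ j, ∃ hj : ψ j ∈ h.domain, h ⟨ψ j, hj⟩ = (e j : ℂ) • ψ j) →
        ∀ A ∈ S.commutant N, ∀ α : Fin N → J, ∃ c : ℂ,
          A (QuantumKac.prodVec fun k => ψ (α k)) = c • QuantumKac.prodVec fun k => ψ (α k) := by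
  have hs := QuantumKac.symmetric_of_isSelfAdjoint hsa
  refine ⟨fun A hA B hB => ?_, fun J ψ e he A hA α =>
    S.exists_apply_prodVec_eq_smul hs hS hN ψ.orthonormal
      (Submodule.dense_iff_topologicalClosure_eq_top.mpr ψ.dense_span) he hA α⟩
  -- A single eigenbasis diagonalizes both `A` and `B`; they commute on its product vectors, which
  -- are total.
  obtain ⟨J, ψ, e, he⟩ := hres.exists_eigenbasis hs
  have hd := Submodule.dense_iff_topologicalClosure_eq_top.mpr (HilbertBasis.dense_span ψ)
  refine ContinuousLinearMap.ext_on (QuantumKac.dense_span_prodVec_of_dense hd) ?_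
  rintro _ ⟨α, rfl⟩
  obtain ⟨a, ha⟩ := S.exists_apply_prodVec_eq_smul hs hS hN ψ.orthonormal hd he hA α
  obtain ⟨b, hb⟩ := S.exists_apply_prodVec_eq_smul hs hS hN ψ.orthonormal hd he hB α
  simp only [mul_apply_eq_comp, ha, hb, map_smul, smul_comm a b]
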